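/- Let $\mathcal P=\mathcal P(\boldsymbol\alpha,\boldsymbol\ell)$ be a curvilinear $n$-gon, $n\ge 1$, with angles $\boldsymbol\alpha=(\alpha_1,\dots,\alpha_n)\in(0,\pi)^n$ and side lengths $\boldsymbol\ell=(\ell_1,\dots,\ell_n)\in(0,\infty)^n$, where the side of length $\ell_j$ joins the vertices $V_{j-1}$ and $V_j$ and all indices are cyclic modulo $n$. Put $\mu_\alpha=\frac{\pi^2}{2\alpha}$. An angle is exceptional if it equals $\frac{\pi}{2k}$ with $k\in\{1,2,\dots\}$; its parity is then $\mathcal O(\alpha)=\cos\mu_\alpha=(-1)^k$. For real $\sigma$ put $$\mathtt A(\alpha)=\begin{pmatrix}\csc\mu_\alpha&-\mathrm i\cot\mu_\alpha\\ \mathrm i\cot\mu_\alpha&\csc\mu_\alpha\end{pmatrix}\ (\alpha\text{ not exceptional}),\qquad \mathtt B(\ell,\sigma)=\begin{pmatrix}\mathrm e^{\mathrm i\ell\sigma}&0\\0&\mathrm e^{-\mathrm i\ell\sigma}\end{pmatrix}.$$ Quasi-eigenvalues without exceptional angles. If no $\alpha_j$ is exceptional, let $\mathtt T(\sigma)=\mathtt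 A(\alpha_n)\mathtt B(\ell_n,\sigma)\cdots\mathtt A(\alpha_1)\mathtt B(\ell_1,\sigma)$. A number $\sigma\ge0$ is a quasi-eigenvalue if $1$ is an eigenvalue of $\mathtt T(\sigma)$. The multiplicity of a quasi-eigenvalue $\sigma>0$ is the geometric multiplicity of the eigenvalue $1$ of $\mathtt T(\sigma)$; the multiplicity of the quasi-eigenvalue $\sigma=0$ (if it is one) is $1$. Quasi-eigenvalues with exceptional angles. If there are $K\ge1$ exceptional angles, the exceptional vertices $V_{E_1},\dots,V_{E_K}$ (in cyclic order, $E_0\equiv E_K$) cut the boundary into $K$ components, the $\kappa$-th one running from $V_{E_{\kappa-1}}$ to $V_{E_\kappa}$; if $K=1$, the only component runs once around the boundary from the exceptional vertex to itself. Let $\mathtt U_\kappa(\sigma)=\mathtt B(\ell_{E_\kappa},\sigma)\mathtt A(\alpha_{E_\kappa-1})\mathtt B(\ell_{E_\kappa-1},\sigma)\cdots\mathtt A(\alpha_{E_{\kappa-1}+1})\mathtt B(\ell_{E_{\kappa-1}+1},\sigma)$ be the product along the $\kappa$-th component. For an exceptional angle $\alpha$ let $\mathbf X(\alpha)=\frac1{\sqrt2}\binom{\mathrm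 e^{-\mathrm i\pi/4}}{\mathrm e^{\mathrm i\pi/4}}$ if $\mathcal O(\alpha)=1$, and $\mathbf X(\alpha)=\frac1{\sqrt2}\binom{\mathrm e^{\mathrm i\pi/4}}{\mathrm e^{-\mathrm i\pi/4}}$ if $\mathcal O(\alpha)=-1$, and let $u\cdot v=u_1\overline{v_1}+u_2\overline{v_2}$ on $\mathbb C^2$. A number $\sigma\ge0$ is a quasi-eigenvalue if for some $\kappa\in\{1,\dots,K\}$ $$\mathtt U_\kappa(\sigma)\mathbf X(\alpha_{E_{\kappa-1}})\cdot\mathbf X(\alpha_{E_\kappa})=0.\qquad(*)$$ The multiplicity of a quasi-eigenvalue $\sigma>0$ is the number of $\kappa$ for which $(*)$ holds; the multiplicity of the quasi-eigenvalue $\sigma=0$ is half the number of $\kappa\in\{1,\dots,K\}$ with $\mathcal O(\alpha_{E_{\kappa-1}})\ne\mathcal O(\alpha_{E_\kappa})$ (the number of such $\kappa$ is always even). The trigonometric polynomial. For $\boldsymbol\zeta\in\{\pm1\}^n$ let $\operatorname{Ch}(\boldsymbol\zeta)=\{j\in\{1,\dots,n\}:\zeta_j\ne\zeta_{j+1}\}$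 with $\zeta_{n+1}=\zeta_1$, and let $$F^{\mathcal P}(\sigma)=\sum_{\substack{\boldsymbol\zeta\in\{\pm1\}^n\\ \zeta_1=1}}\ \prod_{j\in\operatorname{Ch}(\boldsymbol\zeta)}\cos\Big(\frac{\pi^2}{2\alpha_j}\Big)\,\cos\big((\boldsymbol\ell\cdot\boldsymbol\zeta)\sigma\big)\;-\;\prod_{j=1}^n\sin\Big(\frac{\pi^2}{2\alpha_j}\Big),$$ where an empty product is $1$. Theorem. In either case, $\sigma\ge0$ is a quasi-eigenvalue of $\mathcal P$ if and only if $F^{\mathcal P}(\sigma)=0$. The multiplicity of a quasi-eigenvalue $\sigma>0$ equals its multiplicity as a root of $F^{\mathcal P}$, and the multiplicity of the quasi-eigenvalue $\sigma=0$ (if it is one) is half its multiplicity as a root of $F^{\mathcal P}$. -/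

import Mathlib

/-!
The Steklov quasi-eigenvalues of a curvilinear `n`-gon depend on the polygon only through its
vector of angles `α` and its vector of side lengths `ℓ`.  Vertices and sides are indexed by `Fin n`
(so the index `j : Fin n` stands for the vertex `V_{j+1}` and the side `I_{j+1}`), in cyclic order;
the side `j` joins the vertex `j - 1` to the vertex `j`.
-/

namespace SteklovPolygon

noncomputable section

/-- `μ_α = π² / (2 α)`. -/
def mu (a : ℝ) : ℝ := Real.pi ^ 2 / (2 * a)

/-- Exceptional angles: `π / (2 k)` with `k ≥ 1`. -/
def IsExceptional (a : ℝ) : Prop := ∃ k : ℕ, 0 < k ∧ a = Real.pi / (2 * (k : ℝ))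

/-- The parity of an exceptional angle `π / (2 k)`, which is `cos μ_α = (-1) ^ k`. -/
def parity (a : ℝ) : ℝ := Real.cos (mu a)

/-- Vertex transfer matrix (meaningful for a non-exceptional angle). -/
def matA (a : ℝ) : Matrix (Fin 2) (Fin 2) ℂ :=
  !![(((Real.sin (mu a))⁻¹ : ℝ) : ℂ), -Complex.I * ((Real.cot (mu a) : ℝ) : ℂ);
     Complex.I * ((Real.cot (mu a) : ℝ) : ℂ), (((Real.sin (mu a))⁻¹ : ℝ) : ℂ)]

/-- Side transfer matrix. -/
def matB (l σ : ℝ) : Matrix (Fin 2) (Fin 2) ℂ :=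
  !![Complex.exp (Complex.I * l * σ), 0; 0, Complex.exp (-(Complex.I * l * σ))]

def matC (a l σ : ℝ) : Matrix (Fin 2) (Fin 2) ℂ := matA a * matB l σ

/-- `T = C(α_n, ℓ_n, σ) ⋯ C(α_1, ℓ_1, σ)`. -/
def matT {n : ℕ} (α ℓ : Fin n → ℝ) (σ : ℝ) : Matrix (Fin 2) (Fin 2) ℂ :=
  (List.ofFn fun j : Fin n => matC (α j) (ℓ j) σ).reverse.prod

/-- The polygon has an exceptional angle. -/
def HasExceptional {n : ℕ} (α : Fin n → ℝ) : Prop := ∃ j, IsExceptional (α j)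

/-! ### Exceptional boundary components

Going round the boundary, each exceptional vertex `s` is the initial vertex of exactly one
exceptional boundary component, so the components are indexed by the exceptional vertices `s`. -/

/-- The index reached from `s` after `k` cyclic steps. -/
def cyc {n : ℕ} [NeZero n] (s : Fin n) (k : ℕ) : Fin n := Fin.ofNat n (s.val + k)

/-- The number of (non-exceptional) vertices strictly inside the component that starts at the
exceptional vertex `s`.  The infimum is over a nonempty set, since `cyc s n = s`. -/
def innerCount {n : ℕ} [NeZero n] (α : Fin n → ℝ) (s : Fin n) : ℕ :=
  sInf {k : ℕ | IsExceptional (α (cyc s (k + 1)))}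

/-- The exceptional vertex at the end of the component that starts at `s`
(it is `s` itself if there is only one exceptional vertex). -/
def nextExc {n : ℕ} [NeZero n] (α : Fin n → ℝ) (s : Fin n) : Fin n :=
  cyc s (innerCount α s + 1)

/-- `B(ℓ_{s+k+1}) A(α_{s+k}) B(ℓ_{s+k}) ⋯ A(α_{s+1}) B(ℓ_{s+1})`: transfer along the `k + 1` sides
that follow the vertex `s`, through `k` inner vertices. -/
def matU {n : ℕ} [NeZero n] (α ℓ : Fin n → ℝ) (s : Fin n) (σ : ℝ) :
    ℕ → Matrix (Fin 2) (Fin 2) ℂ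
  | 0 => matB (ℓ (cyc s 1)) σ
  | k + 1 => matB (ℓ (cyc s (k + 2))) σ * matA (α (cyc s (k + 1))) * matU α ℓ s σ k

def vecEven : Fin 2 → ℂ :=
  ![((1 / Real.sqrt 2 : ℝ) : ℂ) * Complex.exp (-(Complex.I * (Real.pi / 4))),
    ((1 / Real.sqrt 2 : ℝ) : ℂ) * Complex.exp (Complex.I * (Real.pi / 4))]

def vecOdd : Fin 2 → ℂ :=
  ![((1 / Real.sqrt 2 : ℝ) : ℂ) * Complex.exp (Complex.I * (Real.pi / 4)),
    ((1 / Real.sqrt 2 : ℝ) : ℂ) * Complex.exp (-(Complex.I * (Real.pi / 4)))]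

open Classical in
/-- `X(α)` for an exceptional angle `α`, whose parity is `1` or `-1`. -/
def vecX (a : ℝ) : Fin 2 → ℂ := if parity a = 1 then vecEven else vecOdd

/-- The dot product `u₁ conj v₁ + u₂ conj v₂` in `ℂ²`. -/
def cdot (u v : Fin 2 → ℂ) : ℂ := ∑ i, u i * (starRingEnd ℂ) (v i)

/-- `U X(α_start) · X(α_end) = 0` for the component that starts at the exceptional vertex `s`. -/
def ComponentEq {n : ℕ} [NeZero n] (α ℓ : Fin n → ℝ) (s : Fin n) (σ : ℝ) : Prop :=
  cdot ((matU α ℓ s σ (innerCount α s)).mulVec (vecX (α s))) (vecX (α (nextExc α s))) = 0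

/-! ### Quasi-eigenvalues and their multiplicities -/

open Classical in
def IsQuasiEigenvalue {n : ℕ} [NeZero n] (α ℓ : Fin n → ℝ) (σ : ℝ) : Prop :=
  0 ≤ σ ∧
    if HasExceptional α then ∃ s, IsExceptional (α s) ∧ ComponentEq α ℓ s σ
    else Module.End.HasEigenvalue (Matrix.toLin' (matT α ℓ σ)) 1

/-- The number of components whose two exceptional end vertices have different parities, that is,
the number of sign changes in the cyclic sequence of parities (hence always an even number). -/
def oddComponents {n : ℕ} [NeZero n] (α : Fin n → ℝ) : ℕ :=
  {s : Fin n | IsExceptional (α s) ∧ parity (α s) ≠ parity (α (nextExc α s))}.ncard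

open Classical in
/-- Multiplicity of a quasi-eigenvalue `σ ≥ 0`. -/
def quasiMultiplicity {n : ℕ} [NeZero n] (α ℓ : Fin n → ℝ) (σ : ℝ) : ℕ :=
  if HasExceptional α then
    if σ = 0 then oddComponents α / 2
    else {s : Fin n | IsExceptional (α s) ∧ ComponentEq α ℓ s σ}.ncard
  else
    if σ = 0 then 1
    else Module.finrank ℂ (Module.End.eigenspace (Matrix.toLin' (matT α ℓ σ)) 1)

/-! ### The trigonometric polynomial -/

/-- Indices of cyclic sign changes of `ζ ∈ {±1}ⁿ` (here `j + 1` is taken modulo `n`). -/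
def changes {n : ℕ} [NeZero n] (ζ : Fin n → ℤˣ) : Finset (Fin n) :=
  Finset.univ.filter fun j => ζ j ≠ ζ (j + 1)

def pCoeff {n : ℕ} [NeZero n] (α : Fin n → ℝ) (ζ : Fin n → ℤˣ) : ℝ :=
  ∏ j ∈ changes ζ, Real.cos (mu (α j))

def Feven {n : ℕ} [NeZero n] (α ℓ : Fin n → ℝ) (σ : ℝ) : ℝ :=
  ∑ ζ ∈ Finset.univ.filter (fun ζ : Fin n → ℤˣ => ζ 0 = 1),
    pCoeff α ζ * Real.cos ((∑ j, ℓ j * (((ζ j : ℤˣ) : ℤ) : ℝ)) * σ)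

/-- `F^P = F_even - ∏ sin (π² / (2 α_j))`. -/
def FP {n : ℕ} [NeZero n] (α ℓ : Fin n → ℝ) (σ : ℝ) : ℝ :=
  Feven α ℓ σ - ∏ j, Real.sin (mu (α j))

end

end SteklovPolygon

/-!
In the orthonormal basis `vecEven`, `vecOdd` everything becomes real: the side matrix `B(ℓ, σ)` is
the rotation by `ℓ σ`, and `sin μ • A(α)` is the diagonal matrix with entries `1 ± cos μ`. Expanding
the trace of the product `S(σ)` of these matrices around the polygon over sign sequences, in a basis
that diagonalises the rotations, gives `tr S = 2 F_even`.

A product of rotations and of diagonal matrices with positive determinant moves every vector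
strictly anticlockwise as `σ` grows.

* Without exceptional angles, `T` is `S` divided by `∏ sin μ`, has determinant one, and
  `F^P = -(∏ sin μ / 2) det (T - 1)`. Turning makes `det (T - 1)` vanish at `σ` to the order
  `dim ker (T(σ) - 1)`.
* With exceptional angles, `∏ sin μ = 0`, and the diagonal matrix at an exceptional vertex is twice
  the orthogonal projection onto `X(α)`. So `2 F^P = tr S` is the product of the functions `U X · X`
  of the components, up to constant factors, and turning makes all zeros of these functions simple.

At `σ = 0` the order of vanishing is even because `F^P` is an even function. Without exceptional
angles it is also at most two, so it is exactly two when `0` is a quasi-eigenvalue.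
-/

namespace SteklovPolygon

open Matrix

section PathSum

variable {ι R : Type*} [Fintype ι] [DecidableEq ι] [CommSemiring R]

lemma prod_reverse_ofFn_apply {m : ℕ} (f : Fin (m + 1) → Matrix ι ι R) (x y : ι) :
    (List.ofFn f).reverse.prod x y =
      ∑ ζ : Fin m → ι, ∏ j, f j (Fin.snoc (α := fun _ => ι) ζ x j)
        (Fin.cons (α := fun _ => ι) y ζ j) := by
  induction m generalizing y with
  | zero => simp [Fin.snoc]
  | succ m ih =>
    rw [List.ofFn_succ, List.reverse_cons, List.prod_append, List.prod_singleton, mul_apply,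
      ← (Fin.consEquiv fun _ => ι).sum_comp, Fintype.sum_prod_type]
    refine Finset.sum_congr rfl fun z _ => ?_
    rw [ih, Finset.sum_mul]
    refine Finset.sum_congr rfl fun ζ _ => ?_
    change _ = ∏ j, f j (Fin.snoc (α := fun _ => ι) (Fin.cons z ζ : Fin (m + 1) → ι) x j)
      (Fin.cons (α := fun _ => ι) y (Fin.cons z ζ : Fin (m + 1) → ι) j)
    rw [← Fin.cons_snoc_eq_snoc_cons, Fin.prod_univ_succ (n := m + 1), mul_comm]
    simp only [Fin.cons_zero, Fin.cons_succ]

lemma trace_prod_reverse_ofFn {n : ℕ} [NeZero n] (f : Fin n → Matrix ι ι R) :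
    (List.ofFn f).reverse.prod.trace = ∑ ζ : Fin n → ι, ∏ j, f j (ζ (j + 1)) (ζ j) := by
  obtain ⟨m, rfl⟩ := Nat.exists_eq_succ_of_ne_zero (NeZero.ne n)
  rw [trace, ← (Fin.consEquiv fun _ => ι).sum_comp, Fintype.sum_prod_type]
  refine Finset.sum_congr rfl fun x _ => ?_
  simp only [diag_apply, prod_reverse_ofFn_apply, Fin.consEquiv_apply, Fin.snoc_eq_cons_rotate,
    finRotate_apply]

end PathSum

section CyclicProduct

variable {n : ℕ} [NeZero n]

lemma cyc_eq_add (s : Fin n) (k : ℕ) : cyc s k = s + Fin.ofNat n k := by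
  ext; simp [cyc, Fin.ofNat, Fin.val_add]

@[simp] lemma cyc_zero (s : Fin n) : cyc s 0 = s := by
  ext; simp [cyc, Fin.ofNat, Nat.mod_eq_of_lt]

@[simp] lemma cyc_self (s : Fin n) : cyc s n = s := by
  ext; simp [cyc, Fin.ofNat, Nat.mod_eq_of_lt]

lemma cyc_cyc (s : Fin n) (m k : ℕ) : cyc (cyc s m) k = cyc s (m + k) := by
  ext; simp [cyc, Fin.ofNat, add_assoc]

lemma exists_cyc_eq (s t : Fin n) : ∃ m ≤ n, cyc s m = t :=
  ⟨(t - s).val, (t - s).isLt.le, by simp [cyc_eq_add]⟩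

lemma prod_range_cyc {M : Type*} [CommMonoid M] (f : Fin n → M) (s : Fin n) :
    ∏ i ∈ Finset.range n, f (cyc s i) = ∏ j, f j := by
  rw [← Fin.prod_univ_eq_prod_range (fun i => f (cyc s i)),
    ← Equiv.prod_comp (Equiv.addLeft s) f]
  simp [cyc_eq_add]

/-- The ordered product `f (s + k) ⋯ f (s + 2) * f (s + 1)` of the `k` values of `f` that follow
the index `s` in cyclic order. -/
def cycProd {M : Type*} [Monoid M] (f : Fin n → M) (s : Fin n) : ℕ → M
  | 0 => 1
  | k + 1 => f (cyc s (k + 1)) * cycProd f s k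

section Monoid

variable {M N : Type*} [Monoid M] [Monoid N] (f : Fin n → M) (s : Fin n)

@[simp] lemma cycProd_zero : cycProd f s 0 = 1 := rfl

lemma cycProd_succ (k : ℕ) : cycProd f s (k + 1) = f (cyc s (k + 1)) * cycProd f s k := rfl

lemma cycProd_add (m k : ℕ) : cycProd f s (m + k) = cycProd f (cyc s m) k * cycProd f s m := by
  induction k with
  | zero => simp
  | succ k ih => rw [← add_assoc, cycProd_succ, ih, cycProd_succ, cyc_cyc, mul_assoc, add_assoc]

lemma map_cycProd {F : Type*} [FunLike F M N] [MonoidHomClass F M N] (φ : F) (k : ℕ) :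
    φ (cycProd f s k) = cycProd (fun j => φ (f j)) s k := by
  induction k with
  | zero => simp
  | succ k ih => rw [cycProd_succ, map_mul, ih, cycProd_succ]

lemma prod_reverse_ofFn_eq_cycProd : (List.ofFn f).reverse.prod = cycProd f (-1) n := by
  have range_eq (k : ℕ) :
      cycProd f (-1) k = ((List.range k).map fun i => f (cyc (-1) (i + 1))).reverse.prod := by
    induction k with
    | zero => simp
    | succ k ih => simp [cycProd_succ, ih, List.range_succ]
  have cyc_neg_one (i : Fin n) : cyc (-1) (i + 1) = i := by
    have cyc_one : cyc (-1 : Fin n) 1 = 0 := (cyc_eq_add _ _).trans (neg_add_cancel 1)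
    rw [add_comm, ← cyc_cyc, cyc_one, cyc_eq_add, zero_add, Fin.ofNat_val_eq_self]
  rw [range_eq]
  congr 2
  exact List.ext_getElem (by simp) fun i hi _ => by simp [cyc_neg_one ⟨i, by simpa using hi⟩]

end Monoid

lemma cycProd_eq_prod_range {M : Type*} [CommMonoid M] (f : Fin n → M) (s : Fin n) (k : ℕ) :
    cycProd f s k = ∏ i ∈ Finset.range k, f (cyc s (i + 1)) := by
  induction k with
  | zero => rfl
  | succ k ih => rw [cycProd_succ, ih, Finset.prod_range_succ, mul_comm]

lemma cycProd_self {M : Type*} [CommMonoid M] (f : Fin n → M) (s : Fin n) :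
    cycProd f s n = ∏ j, f j := by
  simp only [cycProd_eq_prod_range, add_comm _ 1, ← cyc_cyc s 1, prod_range_cyc]

lemma cycProd_smul {R A : Type*} [CommMonoid R] [Monoid A] [MulAction R A] [IsScalarTower R A A]
    [SMulCommClass R A A] (c : Fin n → R) (f : Fin n → A) (s : Fin n) (k : ℕ) :
    cycProd (fun j => c j • f j) s k = cycProd c s k • cycProd f s k := by
  induction k with
  | zero => simp
  | succ k ih => simp only [cycProd_succ, ih, smul_mul_smul_comm]

section Matrix

variable {ι κ R : Type*} [Fintype ι] [Fintype κ] [DecidableEq ι] [DecidableEq κ]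

lemma cycProd_mul_of_forall_mul_eq [Semiring R] {f : Fin n → Matrix ι ι R}
    {g : Fin n → Matrix κ κ R} {P : Matrix ι κ R} (h : ∀ j, f j * P = P * g j)
    (s : Fin n) (k : ℕ) : cycProd f s k * P = P * cycProd g s k := by
  induction k with
  | zero => simp
  | succ k ih => rw [cycProd_succ, Matrix.mul_assoc, ih, ← Matrix.mul_assoc, h, Matrix.mul_assoc,
      cycProd_succ]

lemma trace_cycProd_self [CommSemiring R] (f : Fin n → Matrix ι ι R) (s t : Fin n) :
    (cycProd f s n).trace = (cycProd f t n).trace := by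
  obtain ⟨m, hm, rfl⟩ := exists_cyc_eq s t
  obtain ⟨k, hk⟩ := Nat.exists_eq_add_of_le hm
  have rotated : (cycProd f s (m + k)).trace = (cycProd f (cyc s m) (k + m)).trace := by
    rw [cycProd_add, trace_mul_comm, cycProd_add, cyc_cyc, ← hk, cyc_self]
  rwa [add_comm k, ← hk] at rotated

end Matrix

end CyclicProduct

section Model

/-- Rotation of the plane by the angle `t`: the side matrix `B` in the basis `vecEven`, `vecOdd`. -/
noncomputable def rot (t : ℝ) : Matrix (Fin 2) (Fin 2) ℝ :=
  !![Real.cos t, -Real.sin t; Real.sin t, Real.cos t]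

/-- For `c = cos μ`, the rescaled vertex matrix `sin μ • A` in the basis `vecEven`, `vecOdd`.
Unlike `A` it also makes sense at an exceptional angle, where it has rank one. -/
def dil (c : ℝ) : Matrix (Fin 2) (Fin 2) ℝ := diagonal ![1 + c, 1 - c]

lemma det_rot (t : ℝ) : (rot t).det = 1 := by
  rw [rot, det_fin_two_of]
  linear_combination Real.cos_sq_add_sin_sq t

lemma det_dil (c : ℝ) : (dil c).det = 1 - c ^ 2 := by
  simp only [dil, det_diagonal, Fin.prod_univ_two, cons_val_zero, cons_val_one]
  ring

/-- Extension of scalars from `ℝ` to `ℂ` for `2 × 2` matrices. -/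
noncomputable abbrev complexify : Matrix (Fin 2) (Fin 2) ℝ →ₐ[ℝ] Matrix (Fin 2) (Fin 2) ℂ :=
  Complex.ofRealAm.mapMatrix

lemma trace_complexify (M : Matrix (Fin 2) (Fin 2) ℝ) : (complexify M).trace = (M.trace : ℂ) :=
  (AddMonoidHom.map_trace Complex.ofRealHom M).symm

variable {n : ℕ} [NeZero n]

/-- The real model of the transfer through the `k` sides and vertices that follow the vertex `s`:
up to the product of the `sin μ` it is the product of the matrices `C`. -/
noncomputable def transfer (α ℓ : Fin n → ℝ) (s : Fin n) (k : ℕ) (σ : ℝ) :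
    Matrix (Fin 2) (Fin 2) ℝ :=
  cycProd (fun j => dil (Real.cos (mu (α j))) * rot (ℓ j * σ)) s k

lemma transfer_succ (α ℓ : Fin n → ℝ) (s : Fin n) (k : ℕ) (σ : ℝ) :
    transfer α ℓ s (k + 1) σ = dil (Real.cos (mu (α (cyc s (k + 1))))) *
      (rot (ℓ (cyc s (k + 1)) * σ) * transfer α ℓ s k σ) := by
  rw [transfer, cycProd_succ, Matrix.mul_assoc, transfer]

lemma det_transfer (α ℓ : Fin n → ℝ) (s : Fin n) (σ : ℝ) :
    (transfer α ℓ s n σ).det = (∏ j, Real.sin (mu (α j))) ^ 2 := by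
  rw [transfer, ← coe_detMonoidHom, map_cycProd, cycProd_self, ← Finset.prod_pow]
  simp only [coe_detMonoidHom, det_mul, det_dil, det_rot, mul_one, Real.sin_sq]

end Model

section Trace

/-- The complexification of `dil c * rot θ` in a basis, indexed by the two signs, in which the
rotation is diagonal. -/
noncomputable def signStep (c θ : ℝ) : Matrix ℤˣ ℤˣ ℂ :=
  .of fun z w => (if w ≠ z then (c : ℂ) else 1) * Complex.exp ((θ * ((w : ℤ) : ℝ) : ℝ) * Complex.I)

/-- The change of basis between `signStep` and `dil * rot`. -/
noncomputable def signBasis : Matrix ℤˣ (Fin 2) ℂ :=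
  .of fun z => ![1, Complex.I * ((z : ℤ) : ℂ)]

/-- The inverse of `signBasis`. -/
noncomputable def signBasisInv : Matrix (Fin 2) ℤˣ ℂ :=
  .of ![fun _ => 1 / 2, fun z => -Complex.I * ((z : ℤ) : ℂ) / 2]

lemma signBasis_mul_signBasisInv : signBasis * signBasisInv = 1 := by
  ext z w
  rcases Int.units_eq_one_or z with rfl | rfl <;> rcases Int.units_eq_one_or w with rfl | rfl <;>
    simp [Matrix.mul_apply, signBasis, signBasisInv, mul_div_assoc'] <;> norm_num

lemma signBasisInv_mul_signBasis : signBasisInv * signBasis = 1 := by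
  ext z w
  fin_cases z <;> fin_cases w <;>
    simp [Matrix.mul_apply, signBasis, signBasisInv, div_mul_eq_mul_div, ← mul_assoc] <;>
    ring

lemma signStep_mul_signBasis (c θ : ℝ) :
    signStep c θ * signBasis = signBasis * complexify (dil c * rot θ) := by
  have exp_pos := Complex.exp_mul_I θ
  have exp_neg := Complex.exp_mul_I (-θ)
  rw [Complex.cos_neg, Complex.sin_neg, neg_mul] at exp_neg
  ext z w
  rcases Int.units_eq_one_or z with rfl | rfl <;> fin_cases w <;>
    simp [Matrix.mul_apply, signBasis, signStep, dil, rot, exp_pos, exp_neg,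
      Fin.sum_univ_two] <;>
    grind [Complex.I_mul_I]

lemma trace_eq_of_mul_eq {ι κ R : Type*} [Fintype ι] [Fintype κ] [DecidableEq ι] [DecidableEq κ]
    [CommSemiring R] {F : Matrix ι ι R} {G : Matrix κ κ R} {P : Matrix ι κ R} {Q : Matrix κ ι R}
    (hPQ : P * Q = 1) (hQP : Q * P = 1) (h : F * P = P * G) : F.trace = G.trace := by
  rw [← Matrix.mul_one F, ← hPQ, ← Matrix.mul_assoc, h, Matrix.mul_assoc, trace_mul_comm,
    Matrix.mul_assoc, hQP, Matrix.mul_one]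

variable {n : ℕ} [NeZero n]

lemma prod_signStep (c θ : Fin n → ℝ) (ζ : Fin n → ℤˣ) :
    ∏ j, signStep (c j) (θ j) (ζ (j + 1)) (ζ j) = ((∏ j ∈ changes ζ, c j : ℝ) : ℂ) *
      Complex.exp ((∑ j, θ j * ((ζ j : ℤ) : ℝ) : ℝ) * Complex.I) := by
  simp only [signStep, of_apply, Finset.prod_mul_distrib, ← Complex.exp_sum, changes,
    Finset.prod_filter]
  push_cast [Finset.sum_mul, apply_ite]
  rfl

lemma trace_cycProd_dil_mul_rot (c θ : Fin n → ℝ) (s : Fin n) :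
    (cycProd (fun j => dil (c j) * rot (θ j)) s n).trace =
      ∑ ζ : Fin n → ℤˣ, (∏ j ∈ changes ζ, c j) * Real.cos (∑ j, θ j * ((ζ j : ℤ) : ℝ)) := by
  have signs : (cycProd (fun j => signStep (c j) (θ j)) s n).trace =
      ((cycProd (fun j => dil (c j) * rot (θ j)) s n).trace : ℝ) := by
    rw [trace_eq_of_mul_eq signBasis_mul_signBasisInv signBasisInv_mul_signBasis
      (cycProd_mul_of_forall_mul_eq (fun j => signStep_mul_signBasis (c j) (θ j)) s n)]
    rw [← map_cycProd, trace_complexify]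
  rw [trace_cycProd_self _ s (-1), ← prod_reverse_ofFn_eq_cycProd, trace_prod_reverse_ofFn] at signs
  simp only [prod_signStep] at signs
  simpa only [Complex.re_sum, Complex.re_ofReal_mul, Complex.exp_ofReal_mul_I_re,
    Complex.ofReal_re] using (congrArg Complex.re signs).symm

lemma two_mul_Feven (α ℓ : Fin n → ℝ) (σ : ℝ) :
    2 * Feven α ℓ σ =
      ∑ ζ : Fin n → ℤˣ, pCoeff α ζ * Real.cos ((∑ j, ℓ j * ((ζ j : ℤ) : ℝ)) * σ) := by
  have opposite : ∑ ζ : Fin n → ℤˣ with ¬ζ 0 = 1,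
      pCoeff α ζ * Real.cos ((∑ j, ℓ j * ((ζ j : ℤ) : ℝ)) * σ) = Feven α ℓ σ := by
    refine Finset.sum_equiv (Equiv.neg _) (fun ζ => ?_) fun ζ _ => ?_
    · rcases Int.units_eq_one_or (ζ 0) with h | h <;> simp [h]
    · simp [pCoeff, changes]
  rw [two_mul, ← Finset.sum_filter_add_sum_filter_not _ (fun ζ : Fin n → ℤˣ => ζ 0 = 1),
    opposite, Feven]

lemma trace_transfer (α ℓ : Fin n → ℝ) (s : Fin n) (σ : ℝ) :
    (transfer α ℓ s n σ).trace = 2 * Feven α ℓ σ := by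
  simp only [transfer, trace_cycProd_dil_mul_rot, two_mul_Feven, pCoeff, Finset.sum_mul,
    mul_right_comm]

end Trace

section ChangeOfBasis

lemma exp_I_mul_pi_div_four :
    Complex.exp (Complex.I * (Real.pi / 4)) = (Real.sqrt 2 / 2 : ℝ) * (1 + Complex.I) := by
  have hcos : Complex.cos (Real.pi / 4) = (Real.sqrt 2 / 2 : ℝ) := mod_cast Real.cos_pi_div_four
  have hsin : Complex.sin (Real.pi / 4) = (Real.sqrt 2 / 2 : ℝ) := mod_cast Real.sin_pi_div_four
  rw [mul_comm, Complex.exp_mul_I, hcos, hsin]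
  ring

lemma exp_neg_I_mul_pi_div_four :
    Complex.exp (-(Complex.I * (Real.pi / 4))) = (Real.sqrt 2 / 2 : ℝ) * (1 - Complex.I) := by
  have hconj := congrArg (starRingEnd ℂ) exp_I_mul_pi_div_four
  rw [← Complex.exp_conj] at hconj
  simpa [Complex.conj_ofReal, sub_eq_add_neg, map_ofNat] using hconj

lemma one_div_sqrt_two_mul (z : ℂ) :
    ((1 / Real.sqrt 2 : ℝ) : ℂ) * ((Real.sqrt 2 / 2 : ℝ) * z) = z / 2 := by
  have half : 1 / Real.sqrt 2 * (Real.sqrt 2 / 2) = 1 / 2 := by field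
  rw [← mul_assoc, ← Complex.ofReal_mul, half]
  push_cast
  ring

/-- The unitary matrix with columns `vecEven` and `vecOdd`. -/
noncomputable def basisMat : Matrix (Fin 2) (Fin 2) ℂ := (of ![vecEven, vecOdd])ᵀ

lemma basisMat_eq : basisMat =
    !![(1 - Complex.I) / 2, (1 + Complex.I) / 2; (1 + Complex.I) / 2, (1 - Complex.I) / 2] := by
  simp only [basisMat, vecEven, vecOdd, exp_I_mul_pi_div_four, exp_neg_I_mul_pi_div_four,
    one_div_sqrt_two_mul]
  ext i j
  fin_cases i <;> fin_cases j <;> rfl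

lemma conjTranspose_basisMat_mul : basisMatᴴ * basisMat = 1 := by
  rw [basisMat_eq]
  ext i j
  fin_cases i <;> fin_cases j <;> simp [Matrix.mul_apply, map_ofNat] <;> grind [Complex.I_mul_I]

lemma basisMat_mul_conjTranspose : basisMat * basisMatᴴ = 1 :=
  mul_eq_one_comm.1 conjTranspose_basisMat_mul

lemma cdot_mulVec_mulVec {P : Matrix (Fin 2) (Fin 2) ℂ} (hP : Pᴴ * P = 1) (u v : Fin 2 → ℂ) :
    cdot (P *ᵥ u) (P *ᵥ v) = cdot u v := by
  change P *ᵥ u ⬝ᵥ star (P *ᵥ v) = u ⬝ᵥ star v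
  rw [star_mulVec, dotProduct_comm, ← dotProduct_mulVec, mulVec_mulVec, hP, one_mulVec,
    dotProduct_comm]

lemma matB_mul_basisMat (l σ : ℝ) :
    matB l σ * basisMat = basisMat * complexify (rot (l * σ)) := by
  have exp_pos := Complex.exp_mul_I (l * σ)
  have exp_neg := Complex.exp_mul_I (-(l * σ))
  rw [Complex.cos_neg, Complex.sin_neg, neg_mul] at exp_neg
  rw [basisMat_eq, matB, mul_assoc Complex.I, mul_comm Complex.I, exp_pos, exp_neg]
  ext i j
  fin_cases i <;> fin_cases j <;> simp [rot, Matrix.mul_apply] <;> grind [Complex.I_mul_I]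

lemma matA_mul_basisMat (a : ℝ) :
    matA a * basisMat =
      basisMat * complexify ((Real.sin (mu a))⁻¹ • dil (Real.cos (mu a))) := by
  rw [basisMat_eq, matA, Real.cot_eq_cos_div_sin]
  ext i j
  fin_cases i <;> fin_cases j <;> simp [dil, Matrix.mul_apply] <;> grind [Complex.I_mul_I]

lemma matC_mul_basisMat (a l σ : ℝ) :
    matC a l σ * basisMat = basisMat *
      complexify ((Real.sin (mu a))⁻¹ • (dil (Real.cos (mu a)) * rot (l * σ))) := by
  rw [matC, Matrix.mul_assoc, matB_mul_basisMat, ← Matrix.mul_assoc, matA_mul_basisMat,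
    Matrix.mul_assoc, ← map_mul, smul_mul]

variable {n : ℕ} [NeZero n] (α ℓ : Fin n → ℝ)

lemma cycProd_matC_mul_basisMat (s : Fin n) (k : ℕ) (σ : ℝ) :
    cycProd (fun j => matC (α j) (ℓ j) σ) s k * basisMat = basisMat *
      complexify (cycProd (fun j => (Real.sin (mu (α j)))⁻¹) s k • transfer α ℓ s k σ) := by
  rw [cycProd_mul_of_forall_mul_eq (fun j => matC_mul_basisMat (α j) (ℓ j) σ), ← map_cycProd,
    cycProd_smul, transfer]

lemma matU_eq_matB_mul_cycProd (s : Fin n) (k : ℕ) (σ : ℝ) :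
    matU α ℓ s σ k =
      matB (ℓ (cyc s (k + 1))) σ * cycProd (fun j => matC (α j) (ℓ j) σ) s k := by
  induction k with
  | zero => rw [cycProd_zero, Matrix.mul_one, matU]
  | succ k ih => rw [matU, ih, cycProd_succ, matC, Matrix.mul_assoc, ← Matrix.mul_assoc (matA _)]

lemma matU_mul_basisMat (s : Fin n) (k : ℕ) (σ : ℝ) :
    matU α ℓ s σ k * basisMat = basisMat *
      complexify (cycProd (fun j => (Real.sin (mu (α j)))⁻¹) s k •
        (rot (ℓ (cyc s (k + 1)) * σ) * transfer α ℓ s k σ)) := by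
  rw [matU_eq_matB_mul_cycProd, Matrix.mul_assoc, cycProd_matC_mul_basisMat, ← Matrix.mul_assoc,
    matB_mul_basisMat, Matrix.mul_assoc, ← map_mul, Matrix.mul_smul]

end ChangeOfBasis

section Turning

open scoped Matrix.Norms.Operator

variable {σ : ℝ}

section LinearMap

variable {𝕜 E F : Type*} [NontriviallyNormedField 𝕜] [CompleteSpace 𝕜] [NormedAddCommGroup E]
  [NormedSpace 𝕜 E] [FiniteDimensional 𝕜 E] [NormedAddCommGroup F] [NormedSpace 𝕜 F]

lemma analyticAt_linearMap_comp (L : E →ₗ[𝕜] F) {f : 𝕜 → E} {z : 𝕜} (hf : AnalyticAt 𝕜 f z) :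
    AnalyticAt 𝕜 (fun w => L (f w)) z :=
  (L.toContinuousLinearMap.analyticAt _).comp hf

lemma hasDerivAt_linearMap_comp (L : E →ₗ[𝕜] F) {f : 𝕜 → E} {z : 𝕜}
    (hf : DifferentiableAt 𝕜 f z) : HasDerivAt (fun w => L (f w)) (L (deriv f z)) z :=
  L.toContinuousLinearMap.hasFDerivAt.comp_hasDerivAt z hf.hasDerivAt

end LinearMap

lemma analyticAt_det {ι : Type*} [Fintype ι] [DecidableEq ι] {M : ℝ → Matrix ι ι ℝ}
    (hM : AnalyticAt ℝ M σ) : AnalyticAt ℝ (fun t => (M t).det) σ := by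
  have entry (i j : ι) : AnalyticAt ℝ (fun t => M t i j) σ :=
    analyticAt_linearMap_comp (entryLinearMap ℝ ℝ i j) hM
  simp only [det_apply']
  fun_prop

lemma deriv_det {M : ℝ → Matrix (Fin 2) (Fin 2) ℝ} (hM : DifferentiableAt ℝ M σ) :
    deriv (fun t => (M t).det) σ = ((M σ).adjugate * deriv M σ).trace := by
  have entry (i j : Fin 2) : HasDerivAt (fun t => M t i j) (deriv M σ i j) σ :=
    hasDerivAt_linearMap_comp (entryLinearMap ℝ ℝ i j) hM
  simp only [det_fin_two]
  rw [(((entry 0 0).fun_mul (entry 1 1)).fun_sub ((entry 0 1).fun_mul (entry 1 0))).deriv]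
  simp only [adjugate_fin_two, trace_fin_two, Matrix.mul_apply, Fin.sum_univ_two, of_apply,
    cons_val', cons_val_zero, cons_val_one, cons_val_fin_one]
  ring

/-- The oriented area of the parallelogram spanned by two plane vectors. -/
def areaForm (u v : Fin 2 → ℝ) : ℝ := u 0 * v 1 - u 1 * v 0

lemma areaForm_add_right (u v w : Fin 2 → ℝ) :
    areaForm u (v + w) = areaForm u v + areaForm u w := by
  simp only [areaForm, Pi.add_apply]
  ring

lemma areaForm_smul_right (c : ℝ) (u v : Fin 2 → ℝ) :
    areaForm u (c • v) = c * areaForm u v := by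
  simp only [areaForm, Pi.smul_apply, smul_eq_mul]
  ring

lemma areaForm_zero_left (v : Fin 2 → ℝ) : areaForm 0 v = 0 := by simp [areaForm]

lemma areaForm_zero_right (u : Fin 2 → ℝ) : areaForm u 0 = 0 := by simp [areaForm]

lemma areaForm_mulVec_mulVec (A : Matrix (Fin 2) (Fin 2) ℝ) (u v : Fin 2 → ℝ) :
    areaForm (A *ᵥ u) (A *ᵥ v) = A.det * areaForm u v := by
  simp only [areaForm, mulVec, dotProduct, Fin.sum_univ_two, det_fin_two]
  ring

lemma areaForm_quarterTurn (v : Fin 2 → ℝ) : areaForm v (!![0, -1; 1, 0] *ᵥ v) = v ⬝ᵥ v := by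
  simp [areaForm, dotProduct, Fin.sum_univ_two]

/-- An analytic curve of `2 × 2` matrices that moves every nonzero vector strictly anticlockwise
around the origin. -/
structure IsTurning (M : ℝ → Matrix (Fin 2) (Fin 2) ℝ) : Prop where
  analyticAt : ∀ σ, AnalyticAt ℝ M σ
  areaForm_pos : ∀ σ x, x ≠ 0 → 0 < areaForm (M σ *ᵥ x) (deriv M σ *ᵥ x)

lemma rot_eq_smul_add_smul (t : ℝ) :
    rot t = Real.cos t • (1 : Matrix (Fin 2) (Fin 2) ℝ) + Real.sin t • !![0, -1; 1, 0] := by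
  ext i j
  fin_cases i <;> fin_cases j <;> simp [rot]

lemma isTurning_rot {l : ℝ} (hl : 0 < l) : IsTurning fun σ => rot (l * σ) where
  analyticAt σ := by
    simp only [rot_eq_smul_add_smul]
    fun_prop
  areaForm_pos σ x hx := by
    have angle : HasDerivAt (fun t => l * t) l σ := by simpa using (hasDerivAt_id σ).const_mul l
    have deriv_rot := (angle.cos.smul_const (1 : Matrix (Fin 2) (Fin 2) ℝ)).fun_add
      (angle.sin.smul_const !![(0 : ℝ), -1; 1, 0])
    have hderiv : deriv (fun t => rot (l * t)) σ = l • (!![0, -1; 1, 0] * rot (l * σ)) := by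
      simp only [rot_eq_smul_add_smul]
      refine (deriv_rot.congr_deriv ?_).deriv
      have sq : !![(0 : ℝ), -1; 1, 0] * !![0, -1; 1, 0] = -1 := by simp [one_fin_two]
      rw [mul_add, mul_smul_comm, mul_smul_comm, mul_one, sq]
      module
    rw [hderiv, smul_mulVec, areaForm_smul_right, ← mulVec_mulVec, areaForm_quarterTurn]
    refine mul_pos hl (dotProduct_self_star_pos_iff.2 fun h => hx ?_)
    exact eq_zero_of_mulVec_eq_zero (by simp [det_rot]) h

namespace IsTurning

variable {M N : ℝ → Matrix (Fin 2) (Fin 2) ℝ}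

lemma mulVec_ne_zero (hM : IsTurning M) (σ : ℝ) {x : Fin 2 → ℝ} (hx : x ≠ 0) : M σ *ᵥ x ≠ 0 :=
  fun h => (hM.areaForm_pos σ x hx).ne' (by rw [h, areaForm_zero_left])

lemma const_mul (hM : IsTurning M) {C : Matrix (Fin 2) (Fin 2) ℝ} (hC : 0 < C.det) :
    IsTurning fun σ => C * M σ where
  analyticAt σ := analyticAt_const.mul (hM.analyticAt σ)
  areaForm_pos σ x hx := by
    have hderiv : deriv (fun σ => C * M σ) σ = C * deriv M σ :=
      deriv_const_mul _ (hM.analyticAt σ).differentiableAt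
    rw [hderiv, ← mulVec_mulVec, ← mulVec_mulVec, areaForm_mulVec_mulVec]
    exact mul_pos hC (hM.areaForm_pos σ x hx)

lemma mul (hM : IsTurning M) (hN : IsTurning N) (hdet : ∀ σ, 0 ≤ (M σ).det) :
    IsTurning fun σ => M σ * N σ where
  analyticAt σ := (hM.analyticAt σ).mul (hN.analyticAt σ)
  areaForm_pos σ x hx := by
    have hderiv : deriv (fun σ => M σ * N σ) σ = deriv M σ * N σ + M σ * deriv N σ :=
      deriv_fun_mul (hM.analyticAt σ).differentiableAt (hN.analyticAt σ).differentiableAt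
    simp only [hderiv, add_mulVec, areaForm_add_right, ← mulVec_mulVec, areaForm_mulVec_mulVec]
    exact add_pos_of_pos_of_nonneg (hM.areaForm_pos σ _ (hN.mulVec_ne_zero σ hx))
      (mul_nonneg (hdet σ) (hN.areaForm_pos σ x hx).le)

lemma analyticAt_mulVec_apply (hM : IsTurning M) (σ : ℝ) (x : Fin 2 → ℝ) (i : Fin 2) :
    AnalyticAt ℝ (fun t => (M t *ᵥ x) i) σ :=
  analyticAt_linearMap_comp (LinearMap.proj i ∘ₗ (mulVecBilin ℝ ℝ).flip x) (hM.analyticAt σ)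

lemma deriv_mulVec_apply (hM : IsTurning M) (σ : ℝ) (x : Fin 2 → ℝ) (i : Fin 2) :
    deriv (fun t => (M t *ᵥ x) i) σ = (deriv M σ *ᵥ x) i :=
  (hasDerivAt_linearMap_comp (LinearMap.proj i ∘ₗ (mulVecBilin ℝ ℝ).flip x)
    (hM.analyticAt σ).differentiableAt).deriv

lemma analyticOrderAt_mulVec_apply (hM : IsTurning M) {x : Fin 2 → ℝ} (hx : x ≠ 0) {i : Fin 2}
    (h0 : (M σ *ᵥ x) i = 0) : analyticOrderAt (fun t => (M t *ᵥ x) i) σ = 1 := by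
  refine (hM.analyticAt_mulVec_apply σ x i).analyticOrderAt_eq_one_of_zero_deriv_ne_zero h0
    fun h1 => (hM.areaForm_pos σ x hx).ne' ?_
  rw [hM.deriv_mulVec_apply] at h1
  fin_cases i <;> simp_all [areaForm]

lemma det_deriv_ne_zero (hM : IsTurning M) (σ : ℝ) : (deriv M σ).det ≠ 0 := fun h => by
  obtain ⟨x, hx, h0⟩ := exists_mulVec_eq_zero_iff.2 h
  exact (hM.areaForm_pos σ x hx).ne' (by rw [h0, areaForm_zero_right])

lemma analyticAt_det_sub_one (hM : IsTurning M) (σ : ℝ) :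
    AnalyticAt ℝ (fun t => (M t - 1).det) σ :=
  analyticAt_det ((hM.analyticAt σ).sub analyticAt_const)

lemma analyticOrderAt_det_sub_one_of_eq_one (hM : IsTurning M) (h1 : M σ = 1) :
    analyticOrderAt (fun t => (M t - 1).det) σ = 2 := by
  obtain ⟨p, hp⟩ := hM.analyticAt σ
  have slope_analytic : AnalyticAt ℝ (dslope M σ) σ := ⟨_, hp.has_fpower_series_dslope_fslope⟩
  refine (hM.analyticAt_det_sub_one σ).analyticOrderAt_eq_natCast.2
    ⟨fun t => (dslope M σ t).det, analyticAt_det slope_analytic, ?_, .of_forall fun t => ?_⟩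
  · change (dslope M σ σ).det ≠ 0
    rw [dslope_same]
    exact hM.det_deriv_ne_zero σ
  · rw [← h1, ← sub_smul_dslope, det_smul, Fintype.card_fin, smul_eq_mul]

end IsTurning

lemma det_sub_one {R : Type*} [CommRing R] (M : Matrix (Fin 2) (Fin 2) R) :
    (M - 1).det = M.det - M.trace + 1 := by
  rw [det_fin_two, det_fin_two, trace_fin_two]
  simp only [Matrix.sub_apply, one_apply_eq, one_apply_ne zero_ne_one, one_apply_ne one_ne_zero]
  ring

lemma mul_self_eq_zero_of_trace_of_det {R : Type*} [CommRing R] {N : Matrix (Fin 2) (Fin 2) R}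
    (htr : N.trace = 0) (hdet : N.det = 0) : N * N = 0 := by
  rw [trace_fin_two] at htr
  rw [det_fin_two] at hdet
  ext i j
  fin_cases i <;> fin_cases j <;> simp [Matrix.mul_apply] <;> grind

lemma areaForm_mulVec_of_trace_of_det {N : Matrix (Fin 2) (Fin 2) ℝ} (htr : N.trace = 0)
    (hdet : N.det = 0) (H : Matrix (Fin 2) (Fin 2) ℝ) (u : Fin 2 → ℝ) :
    areaForm (N *ᵥ u) (H *ᵥ N *ᵥ u) = (N.adjugate * H).trace * areaForm u (N *ᵥ u) := by
  rw [trace_fin_two] at htr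
  rw [det_fin_two] at hdet
  simp only [areaForm, mulVec, dotProduct, Fin.sum_univ_two, adjugate_fin_two, trace_fin_two,
    Matrix.mul_apply, of_apply, cons_val', cons_val_zero, cons_val_one, cons_val_fin_one]
  grind

lemma IsTurning.analyticOrderAt_det_sub_one_of_ne_one {M : ℝ → Matrix (Fin 2) (Fin 2) ℝ}
    (hM : IsTurning M) (hdet : (M σ).det = 1) (h0 : (M σ - 1).det = 0) (h1 : M σ ≠ 1) :
    analyticOrderAt (fun t => (M t - 1).det) σ = 1 := by
  set N := M σ - 1 with hN
  have trN : N.trace = 0 := by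
    rw [hN, det_sub_one, hdet] at h0
    rw [hN, trace_sub, trace_one, Fintype.card_fin]
    linear_combination -h0
  obtain ⟨u, hu⟩ : ∃ u, N *ᵥ u ≠ 0 := by
    by_contra! h
    exact h1 (sub_eq_zero.1 (ext_of_mulVec_single fun i => by rw [← hN, h, zero_mulVec]))
  have fixed : M σ *ᵥ N *ᵥ u = N *ᵥ u := by
    rw [eq_add_of_sub_eq hN.symm, add_mulVec, mulVec_mulVec,
      mul_self_eq_zero_of_trace_of_det trN h0, zero_mulVec, one_mulVec, zero_add]
  refine (hM.analyticAt_det_sub_one σ).analyticOrderAt_eq_one_of_zero_deriv_ne_zero h0 ?_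
  have hderiv : deriv (fun t => M t - 1) σ = deriv M σ := deriv_sub_const _
  rw [deriv_det ((hM.analyticAt σ).differentiableAt.sub_const 1), hderiv]
  -- Up to a factor, the derivative of the determinant is the turning speed of the vector `N u`.
  have pos := hM.areaForm_pos σ _ hu
  rw [fixed, areaForm_mulVec_of_trace_of_det trN h0] at pos
  exact left_ne_zero_of_mul pos.ne'

open Classical in
lemma IsTurning.analyticOrderAt_det_sub_one {M : ℝ → Matrix (Fin 2) (Fin 2) ℝ}
    (hM : IsTurning M) (hdet : (M σ).det = 1) :
    analyticOrderAt (fun t => (M t - 1).det) σ =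
      if M σ = 1 then 2 else if (M σ - 1).det = 0 then 1 else 0 := by
  split_ifs with h1 h0
  · exact hM.analyticOrderAt_det_sub_one_of_eq_one h1
  · exact hM.analyticOrderAt_det_sub_one_of_ne_one hdet h0 h1
  · exact (hM.analyticAt_det_sub_one σ).analyticOrderAt_eq_zero.2 h0

end Turning

section NonExceptional

lemma analyticOrderAt_const_mul {𝕜 : Type*} [NontriviallyNormedField 𝕜] {c : 𝕜} (hc : c ≠ 0)
    {f : 𝕜 → 𝕜} {z : 𝕜} (hf : AnalyticAt 𝕜 f z) :
    analyticOrderAt (fun w => c * f w) z = analyticOrderAt f z := by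
  have order_mul := analyticOrderAt_mul (analyticAt_const (v := c)) hf
  rwa [analyticAt_const.analyticOrderAt_eq_zero.2 hc, zero_add] at order_mul

variable {n : ℕ} [NeZero n] {α ℓ : Fin n → ℝ} {s : Fin n} {k : ℕ}

lemma IsTurning.const_smul {M : ℝ → Matrix (Fin 2) (Fin 2) ℝ} (hM : IsTurning M) {c : ℝ}
    (hc : c ≠ 0) : IsTurning fun σ => c • M σ := by
  have hdet : 0 < (c • (1 : Matrix (Fin 2) (Fin 2) ℝ)).det := by
    rw [det_smul, det_one, mul_one, Fintype.card_fin]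
    positivity
  simpa only [smul_mul, Matrix.one_mul] using hM.const_mul hdet

lemma det_dil_cos_pos {t : ℝ} (ht : Real.sin t ≠ 0) : 0 < (dil (Real.cos t)).det := by
  rw [det_dil, ← Real.sin_sq]
  positivity

lemma isTurning_rot_mul_transfer (hℓ : ∀ j, 0 < ℓ j)
    (hα : ∀ i < k, Real.sin (mu (α (cyc s (i + 1)))) ≠ 0) :
    IsTurning fun σ => rot (ℓ (cyc s (k + 1)) * σ) * transfer α ℓ s k σ := by
  induction k with
  | zero => simpa only [transfer, cycProd_zero, Matrix.mul_one] using isTurning_rot (hℓ _)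
  | succ k ih =>
    simp only [transfer_succ]
    exact (isTurning_rot (hℓ _)).mul
      ((ih fun i hi => hα i (hi.trans k.lt_succ_self)).const_mul
        (det_dil_cos_pos (hα k k.lt_succ_self)))
      fun σ => by simp only [det_rot, zero_le_one]

lemma isTurning_transfer (hℓ : ∀ j, 0 < ℓ j) (hk : k ≠ 0)
    (hα : ∀ i < k, Real.sin (mu (α (cyc s (i + 1)))) ≠ 0) : IsTurning (transfer α ℓ s k) := by
  obtain ⟨k, rfl⟩ := Nat.exists_eq_succ_of_ne_zero hk
  refine funext (transfer_succ α ℓ s k) ▸ (isTurning_rot_mul_transfer hℓ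
    fun i hi => hα i (hi.trans k.lt_succ_self)).const_mul (det_dil_cos_pos (hα k k.lt_succ_self))

/-- The matrix `T` in the basis `vecEven`, `vecOdd`, when there are no exceptional angles. -/
noncomputable def realT (α ℓ : Fin n → ℝ) (σ : ℝ) : Matrix (Fin 2) (Fin 2) ℝ :=
  (∏ j, Real.sin (mu (α j)))⁻¹ • transfer α ℓ (-1) n σ

lemma matT_mul_basisMat (α ℓ : Fin n → ℝ) (σ : ℝ) :
    matT α ℓ σ * basisMat = basisMat * complexify (realT α ℓ σ) := by
  rw [matT, prod_reverse_ofFn_eq_cycProd, cycProd_matC_mul_basisMat, cycProd_self,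
    Finset.prod_inv_distrib, realT]

lemma matT_sub_one (α ℓ : Fin n → ℝ) (σ : ℝ) :
    matT α ℓ σ - 1 = basisMat * complexify (realT α ℓ σ - 1) * basisMatᴴ := by
  rw [map_sub, map_one, Matrix.mul_sub, Matrix.mul_one, ← matT_mul_basisMat, Matrix.sub_mul,
    Matrix.mul_assoc, basisMat_mul_conjTranspose, Matrix.mul_one]

lemma matT_eq_one_iff (α ℓ : Fin n → ℝ) (σ : ℝ) : matT α ℓ σ = 1 ↔ realT α ℓ σ = 1 := by
  have hT := matT_mul_basisMat α ℓ σ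
  constructor <;> intro h
  · rw [h, Matrix.one_mul] at hT
    have one : complexify (realT α ℓ σ) = complexify 1 := by
      rw [← Matrix.one_mul (complexify _), ← conjTranspose_basisMat_mul, Matrix.mul_assoc, ← hT,
        conjTranspose_basisMat_mul, map_one]
    exact Matrix.map_injective Complex.ofReal_injective one
  · rw [← sub_eq_zero, matT_sub_one, h, sub_self, map_zero, Matrix.mul_zero, Matrix.zero_mul]

lemma det_matT_sub_one (α ℓ : Fin n → ℝ) (σ : ℝ) :
    (matT α ℓ σ - 1).det = ((realT α ℓ σ - 1).det : ℂ) := by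
  rw [matT_sub_one, det_mul_right_comm, basisMat_mul_conjTranspose, Matrix.one_mul]
  exact (RingHom.map_det Complex.ofRealHom _).symm

open Classical in
lemma finrank_ker_toLin' {K : Type*} [Field K] (N : Matrix (Fin 2) (Fin 2) K) :
    Module.finrank K (toLin' N).ker = if N = 0 then 2 else if N.det = 0 then 1 else 0 := by
  split_ifs with hN hdet
  · rw [hN, map_zero, LinearMap.ker_zero, finrank_top, Module.finrank_fin_fun]
  · have pos : 1 ≤ Module.finrank K (toLin' N).ker := by
      obtain ⟨v, hv, h0⟩ := exists_mulVec_eq_zero_iff.2 hdet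
      exact Submodule.one_le_finrank_iff.2 ((Submodule.ne_bot_iff _).2 ⟨v, h0, hv⟩)
    have lt : Module.finrank K (toLin' N).ker < 2 := by
      refine (Submodule.finrank_lt fun h => hN ?_).trans_eq (Module.finrank_fin_fun K)
      rwa [LinearMap.ker_eq_top, map_eq_zero_iff _ toLin'.injective] at h
    lia
  · rw [LinearMap.ker_eq_bot'.2 fun v hv => eq_zero_of_mulVec_eq_zero hdet hv, finrank_bot]

lemma det_realT (hα : ∀ j, Real.sin (mu (α j)) ≠ 0) (σ : ℝ) : (realT α ℓ σ).det = 1 := by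
  have hp : ∏ j, Real.sin (mu (α j)) ≠ 0 := Finset.prod_ne_zero_iff.2 fun j _ => hα j
  rw [realT, det_smul, det_transfer, Fintype.card_fin, inv_pow, inv_mul_cancel₀ (pow_ne_zero 2 hp)]

lemma isTurning_realT (hα : ∀ j, Real.sin (mu (α j)) ≠ 0) (hℓ : ∀ j, 0 < ℓ j) :
    IsTurning (realT α ℓ) :=
  (isTurning_transfer hℓ (NeZero.ne n) fun _ _ => hα _).const_smul
    (inv_ne_zero (Finset.prod_ne_zero_iff.2 fun j _ => hα j))

lemma FP_eq_mul_det_realT_sub_one (hα : ∀ j, Real.sin (mu (α j)) ≠ 0) (σ : ℝ) :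
    FP α ℓ σ = -(∏ j, Real.sin (mu (α j))) / 2 * (realT α ℓ σ - 1).det := by
  have hp : ∏ j, Real.sin (mu (α j)) ≠ 0 := Finset.prod_ne_zero_iff.2 fun j _ => hα j
  rw [det_sub_one, det_realT hα, realT, trace_smul, trace_transfer, FP, smul_eq_mul]
  field_simp
  ring

lemma analyticOrderAt_FP_eq_finrank (hα : ∀ j, Real.sin (mu (α j)) ≠ 0) (hℓ : ∀ j, 0 < ℓ j)
    (σ : ℝ) : analyticOrderAt (FP α ℓ) σ =
      Module.finrank ℂ (Module.End.eigenspace (toLin' (matT α ℓ σ)) 1) := by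
  have eigenspace : Module.End.eigenspace (toLin' (matT α ℓ σ)) 1 =
      (toLin' (matT α ℓ σ - 1)).ker := by
    rw [Module.End.eigenspace_def, one_smul, map_sub, toLin'_one]
    rfl
  rw [eigenspace, finrank_ker_toLin', funext (FP_eq_mul_det_realT_sub_one hα),
    analyticOrderAt_const_mul _ ((isTurning_realT hα hℓ).analyticAt_det_sub_one σ),
    (isTurning_realT hα hℓ).analyticOrderAt_det_sub_one (det_realT hα σ)]
  · simp only [sub_eq_zero, matT_eq_one_iff, det_matT_sub_one, Complex.ofReal_eq_zero]
    split_ifs <;> rfl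
  · exact div_ne_zero (neg_ne_zero.2 (Finset.prod_ne_zero_iff.2 fun j _ => hα j)) two_ne_zero

end NonExceptional

section Angles

lemma mu_pi_div {k : ℕ} (hk : 0 < k) : mu (Real.pi / (2 * k)) = k * Real.pi := by
  rw [mu]
  field_simp

lemma isExceptional_iff_sin_eq_zero {a : ℝ} (ha : 0 < a) :
    IsExceptional a ↔ Real.sin (mu a) = 0 := by
  refine ⟨fun ⟨k, hk, h⟩ => by rw [h, mu_pi_div hk, Real.sin_nat_mul_pi], fun h => ?_⟩
  obtain ⟨m, hm⟩ := Real.sin_eq_zero_iff.1 h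
  have mu_pos : 0 < mu a := div_pos (pow_pos Real.pi_pos 2) (by positivity)
  have m_pos : 0 < m := by exact_mod_cast pos_of_mul_pos_left (hm ▸ mu_pos) Real.pi_pos.le
  lift m to ℕ using m_pos.le
  have hm0 : 0 < m := mod_cast m_pos
  refine ⟨m, hm0, ?_⟩
  rw [Int.cast_natCast, mu] at hm
  field_simp at hm ⊢
  exact hm

lemma IsExceptional.parity_eq_one_or_neg_one {a : ℝ} (ha : IsExceptional a) :
    parity a = 1 ∨ parity a = -1 := by
  obtain ⟨k, hk, rfl⟩ := ha
  rw [parity, mu_pi_div hk, Real.cos_nat_mul_pi]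
  exact neg_one_pow_eq_or ℝ k

open Classical in
/-- The index of `vecX a` in the basis `vecEven`, `vecOdd`. -/
noncomputable def parityIdx (a : ℝ) : Fin 2 := if parity a = 1 then 0 else 1

lemma vecX_eq_basisMat_mulVec (a : ℝ) : vecX a = basisMat *ᵥ Pi.single (parityIdx a) 1 := by
  rw [vecX, parityIdx, mulVec_single_one]
  split_ifs <;> rfl

lemma IsExceptional.dil_cos {a : ℝ} (ha : IsExceptional a) :
    dil (Real.cos (mu a)) = single (parityIdx a) (parityIdx a) 2 := by
  rw [← parity, parityIdx]
  rcases ha.parity_eq_one_or_neg_one with h | h <;> rw [h, dil] <;> ext i j <;>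
    fin_cases i <;> fin_cases j <;> norm_num [single]

lemma parityIdx_eq_iff {a b : ℝ} (ha : IsExceptional a) (hb : IsExceptional b) :
    parityIdx a = parityIdx b ↔ parity a = parity b := by
  rcases ha.parity_eq_one_or_neg_one with h | h <;>
    rcases hb.parity_eq_one_or_neg_one with h' | h' <;> norm_num [parityIdx, h, h']

end Angles

section Components

variable {n : ℕ} [NeZero n] {α ℓ : Fin n → ℝ} {s : Fin n}

lemma isExceptional_nextExc (hs : IsExceptional (α s)) : IsExceptional (α (nextExc α s)) :=
  Nat.sInf_mem (s := {k : ℕ | IsExceptional (α (cyc s (k + 1)))})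
    ⟨n - 1, by simpa [Nat.sub_add_cancel (NeZero.pos n)] using hs⟩

lemma innerCount_le {k : ℕ} (h : IsExceptional (α (cyc s (k + 1)))) : innerCount α s ≤ k :=
  Nat.sInf_le h

lemma not_isExceptional_of_lt_innerCount {i : ℕ} (h : i < innerCount α s) :
    ¬ IsExceptional (α (cyc s (i + 1))) :=
  Nat.notMem_of_lt_sInf h

lemma sin_ne_zero_of_lt_innerCount (hα : ∀ j, 0 < α j) {i : ℕ} (hi : i < innerCount α s) :
    Real.sin (mu (α (cyc s (i + 1)))) ≠ 0 := fun h =>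
  not_isExceptional_of_lt_innerCount hi ((isExceptional_iff_sin_eq_zero (hα _)).2 h)

open Classical in
/-- At an exceptional vertex `s`, the function `U X · X` of `σ` for the component that starts at
`s`, up to a nonzero constant factor; it is `1` at the other vertices. -/
noncomputable def componentFactor (α ℓ : Fin n → ℝ) (s : Fin n) (σ : ℝ) : ℝ :=
  if IsExceptional (α s) then
    2 * ((rot (ℓ (nextExc α s) * σ) * transfer α ℓ s (innerCount α s) σ) *ᵥ
      Pi.single (parityIdx (α s)) 1) (parityIdx (α (nextExc α s)))
  else 1

lemma transfer_mulVec_single_nextExc (hs : IsExceptional (α s)) (σ : ℝ) :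
    transfer α ℓ s (innerCount α s + 1) σ *ᵥ Pi.single (parityIdx (α s)) 1 =
      componentFactor α ℓ s σ • Pi.single (parityIdx (α (nextExc α s))) 1 := by
  rw [transfer_succ, ← nextExc, (isExceptional_nextExc hs).dil_cos, ← mulVec_mulVec,
    single_mulVec_eq, componentFactor, if_pos hs]

lemma prod_range_componentFactor (s : Fin n) (k : ℕ) (σ : ℝ) :
    ∏ i ∈ Finset.range (innerCount α s + 1 + k), componentFactor α ℓ (cyc s i) σ =
      componentFactor α ℓ s σ *
        ∏ i ∈ Finset.range k, componentFactor α ℓ (cyc (nextExc α s) i) σ := by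
  have inner : ∏ i ∈ Finset.range (innerCount α s), componentFactor α ℓ (cyc s (i + 1)) σ = 1 :=
    Finset.prod_eq_one fun i hi =>
      if_neg (not_isExceptional_of_lt_innerCount (Finset.mem_range.1 hi))
  rw [Finset.prod_range_add, Finset.prod_range_succ', inner, one_mul, cyc_zero]
  simp only [nextExc, cyc_cyc]

lemma transfer_mulVec_single (σ : ℝ) (k : ℕ) (s : Fin n) (hs : IsExceptional (α s))
    (hk : IsExceptional (α (cyc s k))) :
    transfer α ℓ s k σ *ᵥ Pi.single (parityIdx (α s)) 1 =
      (∏ i ∈ Finset.range k, componentFactor α ℓ (cyc s i) σ) •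
        Pi.single (parityIdx (α (cyc s k))) 1 := by
  induction k using Nat.strong_induction_on generalizing s with
  | _ k ih =>
    obtain _ | k := k
    · rw [transfer, cycProd_zero, one_mulVec, Finset.prod_range_zero, one_smul, cyc_zero]
    · obtain ⟨r, rfl⟩ := Nat.exists_eq_add_of_le (innerCount_le hk)
      rw [add_right_comm, ← cyc_cyc, ← nextExc] at hk ⊢
      rw [transfer, cycProd_add, ← mulVec_mulVec, ← nextExc, ← transfer, ← transfer,
        transfer_mulVec_single_nextExc hs, mulVec_smul,
        ih r (by lia) _ (isExceptional_nextExc hs) hk, smul_smul, prod_range_componentFactor]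

lemma trace_transfer_eq_prod_componentFactor (hs : IsExceptional (α s)) (σ : ℝ) :
    (transfer α ℓ s n σ).trace = ∏ j, componentFactor α ℓ j σ := by
  have column := transfer_mulVec_single (ℓ := ℓ) σ n s hs (by rwa [cyc_self])
  have rank_one := transfer_succ α ℓ s (n - 1) σ
  rw [Nat.sub_add_cancel (NeZero.pos n), cyc_self, hs.dil_cos] at rank_one
  rw [rank_one, cyc_self, prod_range_cyc (componentFactor α ℓ · σ), ← mulVec_mulVec,
    single_mulVec_eq] at column
  rw [rank_one, trace_single_mul]
  simpa using congrFun column (parityIdx (α s))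

lemma FP_eq_prod_componentFactor (hα : ∀ j, 0 < α j) (h : HasExceptional α) (σ : ℝ) :
    FP α ℓ σ = 2⁻¹ * ∏ j, componentFactor α ℓ j σ := by
  obtain ⟨s, hs⟩ := h
  rw [FP, Finset.prod_eq_zero (Finset.mem_univ s) ((isExceptional_iff_sin_eq_zero (hα s)).1 hs),
    ← trace_transfer_eq_prod_componentFactor hs, trace_transfer]
  ring

lemma isTurning_component (hα : ∀ j, 0 < α j) (hℓ : ∀ j, 0 < ℓ j) (s : Fin n) :
    IsTurning fun σ => rot (ℓ (nextExc α s) * σ) * transfer α ℓ s (innerCount α s) σ :=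
  isTurning_rot_mul_transfer hℓ fun _ => sin_ne_zero_of_lt_innerCount hα

lemma analyticAt_componentFactor (hα : ∀ j, 0 < α j) (hℓ : ∀ j, 0 < ℓ j) (s : Fin n) (σ : ℝ) :
    AnalyticAt ℝ (componentFactor α ℓ s) σ := by
  unfold componentFactor
  split_ifs
  · exact analyticAt_const.mul ((isTurning_component hα hℓ s).analyticAt_mulVec_apply σ _ _)
  · exact analyticAt_const

lemma analyticOrderAt_componentFactor (hα : ∀ j, 0 < α j) (hℓ : ∀ j, 0 < ℓ j) {σ : ℝ}
    (h0 : componentFactor α ℓ s σ = 0) : analyticOrderAt (componentFactor α ℓ s) σ = 1 := by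
  have turning := isTurning_component hα hℓ s
  unfold componentFactor at h0 ⊢
  split_ifs at h0 ⊢ with hs
  · rw [analyticOrderAt_const_mul two_ne_zero (turning.analyticAt_mulVec_apply σ _ _)]
    exact turning.analyticOrderAt_mulVec_apply (Pi.single_ne_zero_iff.2 one_ne_zero)
      ((mul_eq_zero_iff_left two_ne_zero).1 h0)
  · exact absurd h0 one_ne_zero

open Classical in
lemma analyticOrderAt_prod_of_simple {𝕜 ι : Type*} [NontriviallyNormedField 𝕜] {A : Finset ι}
    {f : ι → 𝕜 → 𝕜} {z : 𝕜} (hf : ∀ i ∈ A, AnalyticAt 𝕜 (f i) z)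
    (hsimple : ∀ i ∈ A, f i z = 0 → analyticOrderAt (f i) z = 1) :
    analyticOrderAt (fun w => ∏ i ∈ A, f i w) z = (A.filter fun i => f i z = 0).card := by
  induction A using Finset.induction_on with
  | empty => simpa using analyticAt_const.analyticOrderAt_eq_zero.2 one_ne_zero
  | insert a A ha ih =>
    obtain ⟨hfa, hfA⟩ := (Finset.forall_mem_insert _ _ _).1 hf
    obtain ⟨hsa, hsA⟩ := (Finset.forall_mem_insert _ _ _).1 hsimple
    have order_mul := analyticOrderAt_mul hfa (A.analyticAt_fun_prod hfA)
    simp only [Finset.prod_insert ha]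
    refine order_mul.trans ?_
    rw [ih hfA hsA, Finset.filter_insert]
    split_ifs with h0
    · rw [hsa h0, Finset.card_insert_of_notMem (by simp [ha]), Nat.cast_add_one, add_comm]
    · rw [hfa.analyticOrderAt_eq_zero.2 h0, zero_add]

lemma cdot_single_one (u : Fin 2 → ℂ) (i : Fin 2) : cdot u (Pi.single i 1) = u i := by
  simp [cdot, Pi.single_apply, apply_ite]

lemma componentFactor_eq_zero_iff (hα : ∀ j, 0 < α j) (s : Fin n) (σ : ℝ) :
    componentFactor α ℓ s σ = 0 ↔ IsExceptional (α s) ∧ ComponentEq α ℓ s σ := by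
  have scale : cycProd (fun j => (Real.sin (mu (α j)))⁻¹) s (innerCount α s) ≠ 0 := by
    rw [cycProd_eq_prod_range]
    exact Finset.prod_ne_zero_iff.2 fun i hi =>
      inv_ne_zero (sin_ne_zero_of_lt_innerCount hα (Finset.mem_range.1 hi))
  rw [ComponentEq, vecX_eq_basisMat_mulVec, vecX_eq_basisMat_mulVec, mulVec_mulVec,
    matU_mul_basisMat, ← mulVec_mulVec, cdot_mulVec_mulVec conjTranspose_basisMat_mul,
    cdot_single_one, componentFactor]
  by_cases hs : IsExceptional (α s)
  · simp [hs, scale, nextExc]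
  · simp [hs]

lemma analyticOrderAt_FP_eq_ncard (hα : ∀ j, 0 < α j) (hℓ : ∀ j, 0 < ℓ j)
    (h : HasExceptional α) (σ : ℝ) :
    analyticOrderAt (FP α ℓ) σ = {s | IsExceptional (α s) ∧ ComponentEq α ℓ s σ}.ncard := by
  classical
  have analytic (j : Fin n) (_ : j ∈ Finset.univ) := analyticAt_componentFactor hα hℓ j σ
  rw [funext (FP_eq_prod_componentFactor hα h), analyticOrderAt_const_mul (by positivity)
    (Finset.analyticAt_fun_prod _ analytic), analyticOrderAt_prod_of_simple analytic
    fun _ _ => analyticOrderAt_componentFactor hα hℓ, ← Set.ncard_coe_finset]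
  simp only [componentFactor_eq_zero_iff hα, Finset.coe_filter_univ]

lemma rot_zero : rot 0 = 1 := by simp [rot, one_fin_two]

lemma transfer_zero (α ℓ : Fin n → ℝ) (s : Fin n) (k : ℕ) :
    transfer α ℓ s k 0 = diagonal
      (cycProd (fun j => ![1 + Real.cos (mu (α j)), 1 - Real.cos (mu (α j))]) s k) := by
  simp only [transfer, mul_zero, rot_zero, Matrix.mul_one, dil]
  exact (map_cycProd _ _ (diagonalRingHom (Fin 2) ℝ) k).symm

lemma cycProd_dil_apply_ne_zero {k : ℕ} (hα : ∀ i < k, Real.sin (mu (α (cyc s (i + 1)))) ≠ 0)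
    (e : Fin 2) :
    cycProd (fun j => ![1 + Real.cos (mu (α j)), 1 - Real.cos (mu (α j))]) s k e ≠ 0 := by
  rw [cycProd_eq_prod_range, Finset.prod_apply]
  refine Finset.prod_ne_zero_iff.2 fun i hi => ?_
  have hdet := (det_dil_cos_pos (hα i (Finset.mem_range.1 hi))).ne'
  rw [dil, det_diagonal] at hdet
  exact Finset.prod_ne_zero_iff.1 hdet e (Finset.mem_univ e)

lemma componentFactor_zero_eq_zero_iff (hα : ∀ j, 0 < α j) (s : Fin n) :
    componentFactor α ℓ s 0 = 0 ↔
      IsExceptional (α s) ∧ parity (α s) ≠ parity (α (nextExc α s)) := by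
  rw [componentFactor, mul_zero, rot_zero, Matrix.one_mul, transfer_zero]
  split_ifs with hs
  · rw [Ne, ← parityIdx_eq_iff hs (isExceptional_nextExc hs)]
    have diag_ne_zero := cycProd_dil_apply_ne_zero (k := innerCount α s)
      fun _ => sin_ne_zero_of_lt_innerCount hα
    simp [hs, diag_ne_zero, Pi.single_apply, eq_comm]
  · simp [hs]

end Components

section Multiplicity

open Filter Topology

lemma even_of_analyticOrderAt_zero_eq {𝕜 E : Type*} [NontriviallyNormedField 𝕜]
    [NormedAddCommGroup E] [NormedSpace 𝕜 E] [IsAddTorsionFree E] {f : 𝕜 → E} {m : ℕ}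
    (hf : AnalyticAt 𝕜 f 0) (heven : Function.Even f) (hm : analyticOrderAt f 0 = m) : Even m := by
  obtain ⟨g, hg, hg0, hfg⟩ := hf.analyticOrderAt_eq_natCast.1 hm
  simp only [sub_zero] at hfg
  have neg_tendsto : Tendsto (fun z : 𝕜 => -z) (𝓝 0) (𝓝 0) := by
    simpa using (continuous_neg (G := 𝕜)).tendsto 0
  have g_neg : ∀ᶠ z in 𝓝[≠] 0, (-1 : 𝕜) ^ m • g (-z) = g z := by
    filter_upwards [self_mem_nhdsWithin, nhdsWithin_le_nhds hfg,
      nhdsWithin_le_nhds (neg_tendsto hfg)] with z hz0 hz hnz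
    refine smul_right_injective E (pow_ne_zero m hz0) ?_
    change z ^ m • (-1) ^ m • g (-z) = z ^ m • g z
    rw [smul_smul, ← mul_pow, mul_neg_one, ← hnz, heven, hz]
  have g_zero : (-1 : 𝕜) ^ m • g 0 = g 0 := by
    have right : Tendsto g (𝓝[≠] 0) (𝓝 (g 0)) := hg.continuousAt.mono_left nhdsWithin_le_nhds
    have left : Tendsto (fun z => (-1 : 𝕜) ^ m • g (-z)) (𝓝[≠] 0) (𝓝 ((-1 : 𝕜) ^ m • g 0)) :=
      ((hg.continuousAt.tendsto.comp neg_tendsto).const_smul _).mono_left nhdsWithin_le_nhds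
    exact tendsto_nhds_unique left (right.congr' (g_neg.mono fun _ h => h.symm))
  by_contra odd
  rw [Nat.not_even_iff_odd.1 odd |>.neg_one_pow, neg_one_smul, neg_eq_self] at g_zero
  exact hg0 g_zero

lemma sin_mu_ne_zero {n : ℕ} {α : Fin n → ℝ} (hα : ∀ j, 0 < α j) (h : ¬ HasExceptional α)
    (j : Fin n) : Real.sin (mu (α j)) ≠ 0 :=
  fun h0 => h ⟨j, (isExceptional_iff_sin_eq_zero (hα j)).2 h0⟩

variable {n : ℕ} [NeZero n] {α ℓ : Fin n → ℝ} {σ : ℝ}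

lemma analyticAt_FP (α ℓ : Fin n → ℝ) (σ : ℝ) : AnalyticAt ℝ (FP α ℓ) σ := by
  unfold FP Feven
  fun_prop

lemma even_FP (α ℓ : Fin n → ℝ) : Function.Even (FP α ℓ) := fun σ => by
  simp only [FP, Feven, mul_neg, Real.cos_neg]

open Classical in
/-- The number of independent solutions of the quasi-eigenvalue equations at `σ`. This is the
multiplicity of a quasi-eigenvalue `σ > 0`, and twice that of the quasi-eigenvalue `0`. -/
noncomputable def solutionCount (α ℓ : Fin n → ℝ) (σ : ℝ) : ℕ :=
  if HasExceptional α then {s : Fin n | IsExceptional (α s) ∧ ComponentEq α ℓ s σ}.ncard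
  else Module.finrank ℂ (Module.End.eigenspace (toLin' (matT α ℓ σ)) 1)

lemma isQuasiEigenvalue_iff_solutionCount_ne_zero (hσ : 0 ≤ σ) :
    IsQuasiEigenvalue α ℓ σ ↔ solutionCount α ℓ σ ≠ 0 := by
  rw [IsQuasiEigenvalue, and_iff_right hσ, solutionCount]
  split_ifs
  · rw [← Nat.pos_iff_ne_zero, Set.ncard_pos, Set.Nonempty]
    rfl
  · exact Submodule.finrank_eq_zero.not.symm

lemma quasiMultiplicity_eq_solutionCount (hσ : σ ≠ 0) :
    quasiMultiplicity α ℓ σ = solutionCount α ℓ σ := by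
  simp only [quasiMultiplicity, if_neg hσ, solutionCount]

lemma analyticOrderAt_FP (hα : ∀ j, 0 < α j) (hℓ : ∀ j, 0 < ℓ j) (σ : ℝ) :
    analyticOrderAt (FP α ℓ) σ = solutionCount α ℓ σ := by
  rw [solutionCount]
  split_ifs with h
  · exact analyticOrderAt_FP_eq_ncard hα hℓ h σ
  · exact analyticOrderAt_FP_eq_finrank (sin_mu_ne_zero hα h) hℓ σ

lemma solutionCount_zero_of_hasExceptional (hα : ∀ j, 0 < α j) (h : HasExceptional α) :
    solutionCount α ℓ 0 = oddComponents α := by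
  simp only [solutionCount, if_pos h, ← componentFactor_eq_zero_iff hα,
    componentFactor_zero_eq_zero_iff hα, oddComponents]

lemma solutionCount_le_two (h : ¬ HasExceptional α) : solutionCount α ℓ σ ≤ 2 := by
  rw [solutionCount, if_neg h]
  exact (Submodule.finrank_le _).trans_eq (Module.finrank_fin_fun ℂ)

lemma two_mul_quasiMultiplicity_zero (hα : ∀ j, 0 < α j) (hℓ : ∀ j, 0 < ℓ j)
    (h0 : solutionCount α ℓ 0 ≠ 0) : 2 * quasiMultiplicity α ℓ 0 = solutionCount α ℓ 0 := by
  have even : Even (solutionCount α ℓ 0) := even_of_analyticOrderAt_zero_eq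
    (analyticAt_FP α ℓ 0) (even_FP α ℓ) (analyticOrderAt_FP hα hℓ 0)
  simp only [quasiMultiplicity, if_true]
  split_ifs with h
  · rw [← solutionCount_zero_of_hasExceptional (ℓ := ℓ) hα h, Nat.two_mul_div_two_of_even even]
  · have le_two := solutionCount_le_two (ℓ := ℓ) (σ := 0) h
    obtain ⟨m, hm⟩ := even
    lia

end Multiplicity

end SteklovPolygon

open SteklovPolygon in
theorem mainTheorem4_general (n : ℕ) [NeZero n] (α ℓ : Fin n → ℝ)
    (hα : ∀ j, 0 < α j) (hℓ : ∀ j, 0 < ℓ j) :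
    (∀ σ : ℝ, 0 ≤ σ → (IsQuasiEigenvalue α ℓ σ ↔ FP α ℓ σ = 0)) ∧
    (∀ σ : ℝ, 0 < σ → IsQuasiEigenvalue α ℓ σ →
      analyticOrderAt (fun x : ℝ => FP α ℓ x) σ = (quasiMultiplicity α ℓ σ : ℕ∞)) ∧
    (IsQuasiEigenvalue α ℓ 0 →
      analyticOrderAt (fun x : ℝ => FP α ℓ x) 0 = 2 * (quasiMultiplicity α ℓ 0 : ℕ∞)) := by
  have order := analyticOrderAt_FP hα hℓ
  refine ⟨fun σ hσ => ?_, fun σ hσ _ => ?_, fun h => ?_⟩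
  · rw [isQuasiEigenvalue_iff_solutionCount_ne_zero hσ, ← Nat.cast_ne_zero (R := ℕ∞), ← order]
    exact (analyticAt_FP α ℓ σ).analyticOrderAt_ne_zero
  · rw [order, quasiMultiplicity_eq_solutionCount hσ.ne']
  · rw [isQuasiEigenvalue_iff_solutionCount_ne_zero le_rfl] at h
    rw [order, ← two_mul_quasiMultiplicity_zero hα hℓ h, Nat.cast_mul, Nat.cast_ofNat]

theorem mainTheorem4 (n : ℕ) [NeZero n] (α ℓ : Fin n → ℝ)
    (hα : ∀ j, 0 < α j ∧ α j < Real.pi) (hℓ : ∀ j, 0 < ℓ j) :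
    (∀ σ : ℝ, 0 ≤ σ →
      (SteklovPolygon.IsQuasiEigenvalue α ℓ σ ↔ SteklovPolygon.FP α ℓ σ = 0)) ∧
    (∀ σ : ℝ, 0 < σ → SteklovPolygon.IsQuasiEigenvalue α ℓ σ →
      analyticOrderAt (fun x : ℝ => SteklovPolygon.FP α ℓ x) σ =
        (SteklovPolygon.quasiMultiplicity α ℓ σ : ℕ∞)) ∧
    (SteklovPolygon.IsQuasiEigenvalue α ℓ 0 →
      analyticOrderAt (fun x : ℝ => SteklovPolygon.FP α ℓ x) 0 =
        2 * (SteklovPolygon.quasiMultiplicity α ℓ 0 : ℕ∞)) :=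
  mainTheorem4_general n α ℓ (fun j => (hα j).1) hℓ
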